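/- All neural networks below are layered and feed-forward: each neuron of a layer receives the outputs of all neurons of the previous layer (of the inputs, for the first layer). Write $\sigma_2(z)=z^2$. A neuron with input weights $w$ and bias $\beta$ maps $y$ to $\sigma_2(w^\top y+\beta)$ if it is hidden, and to $w^\top y+\beta$ if it is the (single) output neuron. For $d,t,n\in\mathbb N$ and $L>0$ let $\mathcal N_{t,n,\sigma_2,L}$ be the class of functions $\mathbb R^d\to\mathbb R$ computed by such networks with $d$ inputs, exactly $t$ layers (the output layer counted, the input not), exactly $n$ neurons in total (the inputs not counted), and $\|w\|_1+|\beta|\le L$ for every neuron. Turing machines are deterministic, with finitely many two-way infinite tapes, one of which initially holds the input with the head on its first symbol (the others being blank), and with distinct accepting and rejecting halting states. The size of a machine is the total number of its tapes, states and tape symbols. For $T:\mathbb N\to\mathbb N$ and $s,d\in\mathbb N$ let $\mathcal F_d^{(s)}$ be the set of all functions $f:\{0,1\}^d\to\{0,1\}$ for which there is a Turing machine of size at most $s$ that, on every input $x\in\{0,1\}^d$, halts after at most $T(d)$ operations, accepting if $f(x)=1$ and rejecting if $f(x)=0$. **Theorem.** For every $T:\mathbb N\to\mathbb N$ and every $s\in\mathbb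 N$ there exist constants $b,c>0$ such that for every $d$, with $t=\lfloor c\,T(d)\log T(d)+b\rfloor$ (where $0\log 0=0$), $n=t^2$ and $L=b$, the class $\mathcal N_{t,n,\sigma_2,L}$ contains $\mathcal F_d^{(s)}$: for every $f\in\mathcal F_d^{(s)}$ there is $g\in\mathcal N_{t,n,\sigma_2,L}$ with $g(x)=f(x)$ for all $x\in\{0,1\}^d$. -/

import Mathlib

open Turing

/-- A deterministic multi-tape Turing machine that decides Boolean strings.  It has `k + 1` two-way
infinite tapes, the input being written on tape `0`; the blank symbol is `default : Γ`.  A move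
`none` leaves the head where it is. -/
structure BoolTM where
  /-- states -/
  Q : Type
  /-- tape symbols -/
  Γ : Type
  /-- number of tapes besides the input tape -/
  k : ℕ
  [finQ : Fintype Q]
  [decQ : DecidableEq Q]
  [finΓ : Fintype Γ]
  [blankΓ : Inhabited Γ]
  /-- the two input symbols -/
  bit : Bool → Γ
  bit_injective : Function.Injective bit
  bit_ne_blank : ∀ a, bit a ≠ default
  start : Q
  accept : Q
  reject : Q
  accept_ne_reject : accept ≠ reject
  /-- transition function: new state, and for every tape the symbol written and the move -/
  δ : Q → (Fin (k + 1) → Γ) → Q × (Fin (k + 1) → Γ × Option Dir)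

attribute [instance] BoolTM.finQ BoolTM.decQ BoolTM.finΓ BoolTM.blankΓ

namespace BoolTM

/-- Configurations: the current state and the tapes (with their heads). -/
structure Cfg (M : BoolTM) where
  state : M.Q
  tape : Fin (M.k + 1) → Tape M.Γ

/-- Size of the description of a machine: the number of its tapes, states and symbols. -/
def size (M : BoolTM) : ℕ := (M.k + 1) + Fintype.card M.Q + Fintype.card M.Γ

/-- Start configuration on the input `x`: the head of tape `0` is on the first symbol of `x`, all
other tapes are blank. -/
def init (M : BoolTM) {d : ℕ} (x : Fin d → Bool) : M.Cfg where
  state := M.start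
  tape := fun j => Tape.mk₁ (if j = 0 then List.ofFn (fun i => M.bit (x i)) else [])

/-- Effect of one operation on one tape: write a symbol, then possibly move the head. -/
def updateTape {M : BoolTM} (a : M.Γ × Option Dir) (τ : Tape M.Γ) : Tape M.Γ :=
  match a.2 with
  | none => τ.write a.1
  | some dir => (τ.write a.1).move dir

/-- One operation of the machine; a machine in its accepting or rejecting state has halted. -/
def step (M : BoolTM) (C : M.Cfg) : M.Cfg :=
  if C.state = M.accept ∨ C.state = M.reject then C
  else
    let r := M.δ C.state (fun j => (C.tape j).head)
    { state := r.1, tape := fun j => updateTape (r.2 j) (C.tape j) }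

/-- On every input of length `d`, the machine `M` halts after at most `n` operations, accepting `x`
if `f x` is true and rejecting `x` otherwise. -/
def ImplementsInTime (M : BoolTM) {d : ℕ} (f : (Fin d → Bool) → Bool) (n : ℕ) : Prop :=
  ∀ x : Fin d → Bool, ∃ m ≤ n,
    (M.step^[m] (M.init x)).state = if f x = true then M.accept else M.reject

end BoolTM

/-- The Boolean functions of `d` variables that can be implemented by a Turing machine of size at
most `s` using at most `T d` operations. -/
def turingClass (s : ℕ) (T : ℕ → ℕ) (d : ℕ) : Set ((Fin d → Bool) → Bool) :=
  {f | ∃ M : BoolTM, M.size ≤ s ∧ M.ImplementsInTime f (T d)}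

/-- The parameters of a neuron with `m` inputs. -/
structure Neuron (m : ℕ) where
  weight : Fin m → ℝ
  bias : ℝ

namespace Neuron

/-- The weighted sum of the inputs plus the bias term. -/
noncomputable def preact {m : ℕ} (v : Neuron m) (x : Fin m → ℝ) : ℝ :=
  ∑ i, v.weight i * x i + v.bias

/-- The quantity `‖w‖₁ + |b|`. -/
noncomputable def l1 {m : ℕ} (v : Neuron m) : ℝ := ∑ i, |v.weight i| + |v.bias|

end Neuron

/-- Layered feed-forward networks with `m` inputs and one output neuron: either just the output
neuron, or a nonempty hidden layer of `n` neurons followed by a network with `n` inputs. -/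
inductive Network : ℕ → Type
  | output {m : ℕ} (v : Neuron m) : Network m
  | hidden {m n : ℕ} (hn : 0 < n) (layer : Fin n → Neuron m) (rest : Network n) : Network m

namespace Network

/-- Number of layers, the output layer included and the input excluded. -/
def depth : {m : ℕ} → Network m → ℕ
  | _, output _ => 1
  | _, hidden _ _ rest => rest.depth + 1

/-- Number of neurons, the output neuron included and the inputs excluded. -/
def size : {m : ℕ} → Network m → ℕ
  | _, output _ => 1
  | _, hidden (n := n) _ _ rest => n + rest.size

/-- The function computed by the network: `σ` is applied at the hidden neurons, the output neuron
is linear. -/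
noncomputable def eval (σ : ℝ → ℝ) : {m : ℕ} → Network m → (Fin m → ℝ) → ℝ
  | _, output v, x => v.preact x
  | _, hidden _ layer rest, x => rest.eval σ (fun j => σ ((layer j).preact x))

/-- Every neuron satisfies `‖w‖₁ + |b| ≤ L`. -/
def WeightBounded (L : ℝ) : {m : ℕ} → Network m → Prop
  | _, output v => v.l1 ≤ L
  | _, hidden _ layer rest => (∀ j, (layer j).l1 ≤ L) ∧ rest.WeightBounded L

end Network

/-- The class of functions of `d` real variables implemented by a network of depth `t`, size `n`,
activation function `σ` and weight bound `L`. -/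
def networkClass (d t n : ℕ) (σ : ℝ → ℝ) (L : ℝ) : Set ((Fin d → ℝ) → ℝ) :=
  {g | ∃ N : Network d, N.depth = t ∧ N.size = n ∧ N.WeightBounded L ∧ N.eval σ = g}

/-- The squared activation function. -/
def squareActivation (z : ℝ) : ℝ := z ^ 2

/-- The truth values as the real numbers `0` and `1`. -/
def boolToReal (a : Bool) : ℝ := if a = true then 1 else 0

/-! The network simulates the machine one operation at a time. A configuration is stored one-hot:
state bits, and symbol bits for the cells within distance `n - i` of each head after `i` of `n`
operations. Each new bit is a function of boundedly many old bits (`step_bit_eq`), each within one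
cell of the new window, so the window may shrink by one per operation.

Squaring neurons with weights at most 2 compute XOR and a multiplexer exactly on bits, so Shannon
expansion (`reaches_sum_of_dependsOn`) gives every function of boundedly many bits in bounded depth.
Hence `T d` operations need depth and average width linear in `T d`, with constants depending only
on `s`; padding gives exactly `t` layers and `t ^ 2` neurons. The logarithm in `t` is pure slack. -/

/-! ### Gates computed by a single squaring neuron -/

/-- `g` is an affine combination of the family `F` of Boolean functions, with coefficients of total
absolute value at most `l`. -/
def IsAffine {X ι : Type} [Fintype ι] (F : ι → X → Bool) (g : X → ℝ) (l : ℝ) : Prop :=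
  ∃ v : ι → ℝ, ∃ β : ℝ, ∑ i, |v i| + |β| ≤ l ∧ ∀ x, ∑ i, v i * boolToReal (F i x) + β = g x

namespace IsAffine

variable {X ι : Type} [Fintype ι] {F : ι → X → Bool}

theorem const (c : ℝ) : IsAffine F (fun _ => c) |c| :=
  ⟨fun _ => 0, c, by simp, by simp⟩

theorem var (i : ι) : IsAffine F (fun x => boolToReal (F i x)) 1 := by
  classical
  refine ⟨Pi.single i 1, 0, ?_, fun x => ?_⟩
  · rw [Finset.sum_eq_single i] <;> simp +contextual
  · rw [Finset.sum_eq_single i] <;> simp +contextual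

theorem add {g h : X → ℝ} {l l' : ℝ} (hg : IsAffine F g l) (hh : IsAffine F h l') :
    IsAffine F (fun x => g x + h x) (l + l') := by
  obtain ⟨v, β, hv, hg⟩ := hg
  obtain ⟨w, γ, hw, hh⟩ := hh
  refine ⟨fun i => v i + w i, β + γ, ?_, fun x => ?_⟩
  · have h1 : ∑ i, |v i + w i| ≤ ∑ i, |v i| + ∑ i, |w i| := by
      rw [← Finset.sum_add_distrib]
      exact Finset.sum_le_sum fun i _ => abs_add_le _ _
    have h2 := abs_add_le β γ
    linarith
  · simp only [← hg, ← hh, add_mul, Finset.sum_add_distrib]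
    ring

theorem smul {g : X → ℝ} {l : ℝ} (c : ℝ) (hg : IsAffine F g l) :
    IsAffine F (fun x => c * g x) (|c| * l) := by
  obtain ⟨v, β, hv, hg⟩ := hg
  refine ⟨fun i => c * v i, c * β, ?_, fun x => ?_⟩
  · simp only [abs_mul, ← Finset.mul_sum, ← mul_add]
    exact mul_le_mul_of_nonneg_left hv (abs_nonneg c)
  · simp only [← hg, mul_assoc, ← Finset.mul_sum]
    ring

theorem mono {g : X → ℝ} {l l' : ℝ} (hg : IsAffine F g l) (hl : l ≤ l') : IsAffine F g l' := by
  obtain ⟨v, β, hv, hg⟩ := hg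
  exact ⟨v, β, hv.trans hl, hg⟩

end IsAffine

theorem boolToReal_sq (a : Bool) : boolToReal a ^ 2 = boolToReal a := by
  cases a <;> simp [boolToReal]

/-- The family `G` is computed from `F` by one hidden layer with weights at most `2`. -/
def IsLayer {X ι κ : Type} [Fintype ι] (F : ι → X → Bool) (G : κ → X → Bool) : Prop :=
  ∀ k, ∃ g : X → ℝ, IsAffine F g 2 ∧ ∀ x, g x ^ 2 = boolToReal (G k x)

theorem exists_isAffine_copy {X ι : Type} [Fintype ι] (F : ι → X → Bool) (i : ι) :
    ∃ g : X → ℝ, IsAffine F g 2 ∧ ∀ x, g x ^ 2 = boolToReal (F i x) :=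
  ⟨_, (IsAffine.var i).mono one_le_two, fun x => boolToReal_sq (F i x)⟩

theorem exists_isAffine_const {X ι : Type} [Fintype ι] (F : ι → X → Bool) (a : Bool) :
    ∃ g : X → ℝ, IsAffine F g 2 ∧ ∀ x, g x ^ 2 = boolToReal a :=
  ⟨_, (IsAffine.const (boolToReal a)).mono (by cases a <;> simp [boolToReal]),
    fun _ => boolToReal_sq a⟩

theorem exists_isAffine_unary {X ι : Type} [Fintype ι] (F : ι → X → Bool) (i : ι)
    (h : Bool → Bool) : ∃ g : X → ℝ, IsAffine F g 2 ∧ ∀ x, g x ^ 2 = boolToReal (h (F i x)) := by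
  refine ⟨_, ((IsAffine.const (boolToReal (h false))).add
    ((IsAffine.var i).smul (boolToReal (h true) - boolToReal (h false)))).mono ?_, fun x => ?_⟩
  · cases h true <;> cases h false <;> norm_num [boolToReal]
  · cases F i x <;> cases h true <;> cases h false <;> simp [boolToReal]

theorem exists_isAffine_xor {X ι : Type} [Fintype ι] (F : ι → X → Bool) (i j : ι) :
    ∃ g : X → ℝ, IsAffine F g 2 ∧ ∀ x, g x ^ 2 = boolToReal (xor (F i x) (F j x)) := by
  refine ⟨_, ((IsAffine.var i).add ((IsAffine.var j).smul (-1))).mono (by norm_num), fun x => ?_⟩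
  cases F i x <;> cases F j x <;> simp [boolToReal]

/-- From `u`, `v`, `xor a u`, `xor a v` one neuron computes `if a then u else v`. -/
theorem exists_isAffine_cond {X ι : Type} [Fintype ι] (F : ι → X → Bool) (a : X → Bool)
    (i j i' j' : ι) (hi : ∀ x, F i' x = xor (a x) (F i x)) (hj : ∀ x, F j' x = xor (a x) (F j x)) :
    ∃ g : X → ℝ, IsAffine F g 2 ∧ ∀ x, g x ^ 2 = boolToReal (cond (a x) (F i x) (F j x)) := by
  -- With `u`, `v` the two branches, `u + v - xor a u + xor a v` is `2u` if `a` holds and `2v`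
  -- otherwise; halving brings the total weight to 2.
  refine ⟨_, ((((IsAffine.var i).add (IsAffine.var j)).add
    (((IsAffine.var i').smul (-1)).add (IsAffine.var j'))).smul (1 / 2)).mono ?_, fun x => ?_⟩
  · rw [abs_of_pos (by norm_num)]
    norm_num
  · rw [hi, hj]
    cases a x <;> cases F i x <;> cases F j x <;> norm_num [boolToReal]

/-! ### Composing layers and padding networks -/

/-- Some network of depth `t` and size `n` with weights at most `2` computes `f` from `F`. -/
def ComputesFrom {X ι : Type} [Fintype ι] (F : ι → X → Bool) (f : X → Bool) (t n : ℕ) : Prop :=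
  ∀ (m : ℕ) (e : Fin m ≃ ι), ∃ N : Network m, N.depth = t ∧ N.size = n ∧ N.WeightBounded 2 ∧
    ∀ x, N.eval squareActivation (fun i => boolToReal (F (e i) x)) = boolToReal (f x)

theorem IsAffine.exists_neuron {X ι : Type} [Fintype ι] {F : ι → X → Bool} {g : X → ℝ} {l : ℝ}
    (hg : IsAffine F g l) {m : ℕ} (e : Fin m ≃ ι) :
    ∃ v : Neuron m, v.l1 ≤ l ∧ ∀ x, v.preact (fun i => boolToReal (F (e i) x)) = g x := by
  obtain ⟨w, β, hw, hg⟩ := hg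
  refine ⟨⟨fun i => w (e i), β⟩, ?_, fun x => ?_⟩
  · rw [Neuron.l1, e.sum_comp fun i => |w i|]
    exact hw
  · rw [Neuron.preact, ← hg, e.sum_comp fun i => w i * boolToReal (F i x)]

theorem ComputesFrom.of_isLayer {X ι κ : Type} [Fintype ι] [Fintype κ] [Nonempty κ]
    {F : ι → X → Bool} {G : κ → X → Bool} (h : IsLayer F G) {f : X → Bool} {t n : ℕ}
    (hG : ComputesFrom G f t n) : ComputesFrom F f (t + 1) (n + Fintype.card κ) := by
  intro m e
  obtain ⟨N, ht, hn, hw, hN⟩ := hG _ (Fintype.equivFin κ).symm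
  choose g hg hgG using h
  choose v hv hvg using fun k => (hg k).exists_neuron e
  refine ⟨.hidden Fintype.card_pos (fun j => v ((Fintype.equivFin κ).symm j)) N,
    ?_, ?_, ?_, fun x => ?_⟩
  · rw [Network.depth, ht]
  · rw [Network.size, hn, add_comm]
  · rw [Network.WeightBounded]
    exact ⟨fun j => hv _, hw⟩
  · rw [Network.eval, ← hN]
    simp only [hvg, squareActivation, hgG]

theorem ComputesFrom.output {X ι : Type} [Fintype ι] (F : ι → X → Bool) (i : ι) :
    ComputesFrom F (F i) 1 1 := by
  intro m e
  obtain ⟨v, hv, hvF⟩ := ((IsAffine.var (F := F) i).mono one_le_two).exists_neuron e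
  exact ⟨.output v, by rw [Network.depth], by rw [Network.size], by rwa [Network.WeightBounded],
    fun x => by rw [Network.eval, hvF]⟩

theorem ComputesFrom.thin {X ι : Type} [Fintype ι] (F : ι → X → Bool) (i : ι) (t : ℕ) :
    ComputesFrom F (F i) (t + 1) (t + 1) := by
  induction t generalizing ι with
  | zero => exact .output F i
  | succ t ih =>
    have h := ih (fun _ : Unit => F i) ()
    exact h.of_isLayer fun _ => exists_isAffine_copy F i

/-- All surplus neurons are identical copies in the first hidden layer; the later layers have one
neuron each. This needs a hidden layer, hence `2 ≤ t`. -/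
theorem ComputesFrom.padded {X ι : Type} [Fintype ι] (F : ι → X → Bool) (i : ι) {t n : ℕ}
    (ht : 2 ≤ t) (hn : t ≤ n) : ComputesFrom F (F i) t n := by
  obtain ⟨t, rfl⟩ := Nat.exists_eq_add_of_le' ht
  obtain ⟨n, rfl⟩ := Nat.exists_eq_add_of_le' hn
  have h := (ComputesFrom.thin (fun _ : Fin (n + 1) => F i) 0 t).of_isLayer
    fun _ => exists_isAffine_copy F i
  rw [Fintype.card_fin] at h
  convert h using 1
  omega

/-- `G` is computed from `F` by `D` hidden layers of at most `W` neurons on average. -/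
def Reaches {X ι κ : Type} [Fintype ι] [Fintype κ] (F : ι → X → Bool) (G : κ → X → Bool)
    (D W : ℕ) : Prop :=
  ∃ N ≤ D * W, ∀ f t n, ComputesFrom G f t n → ComputesFrom F f (t + D) (n + N)

namespace Reaches

variable {X ι κ μ : Type} [Fintype ι] [Fintype κ] [Fintype μ] {F : ι → X → Bool}
  {G : κ → X → Bool} {H : μ → X → Bool}

theorem of_isLayer [Nonempty κ] (h : IsLayer F G) {W : ℕ} (hW : Fintype.card κ ≤ W) :
    Reaches F G 1 W :=
  ⟨_, by rwa [one_mul], fun _ _ _ hG => hG.of_isLayer h⟩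

theorem trans {D D' W : ℕ} (h : Reaches F G D W) (h' : Reaches G H D' W) :
    Reaches F H (D + D') W := by
  obtain ⟨N, hN, h⟩ := h
  obtain ⟨N', hN', h'⟩ := h'
  refine ⟨N + N', by linarith, fun f t n hH => ?_⟩
  have := h _ _ _ (h' _ _ _ hH)
  convert this using 1 <;> omega

theorem mono {D W W' : ℕ} (h : Reaches F G D W) (hW : W ≤ W') : Reaches F G D W' := by
  obtain ⟨N, hN, h⟩ := h
  exact ⟨N, hN.trans (Nat.mul_le_mul_left D hW), h⟩

end Reaches

/-! ### Bounded-arity Boolean functions by Shannon expansion -/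

/-- Boolean functions of `m` members of a family are computed in depth `2 * m + 1`. -/
theorem reaches_sum_of_dependsOn {X ι : Type} [Fintype ι] [Nonempty ι] (F : ι → X → Bool) (m : ℕ) :
    ∀ {κ : Type} [Fintype κ] (v : κ → Fin m → ι) (H : κ → (ι → Bool) → Bool),
      (∀ k, DependsOn (H k) (Set.range (v k))) →
      Reaches F (Sum.elim (fun k x => H k fun i => F i x) F) (2 * m + 1)
        (4 * 2 ^ m * Fintype.card κ + Fintype.card ι) := by
  classical
  induction m with
  | zero =>
    intro κ _ v H hH
    refine Reaches.of_isLayer ?_ (by rw [Fintype.card_sum]; omega)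
    rintro (k | i)
    · obtain ⟨g, hg, hgx⟩ := exists_isAffine_const F (H k fun _ => false)
      refine ⟨g, hg, fun x => ?_⟩
      rw [hgx, Sum.elim_inl, hH k (y := fun i => F i x) (by simp)]
    · exact exists_isAffine_copy F i
  | succ m ih =>
    intro κ _ v H hH
    -- The two cofactors with respect to the pivot `v k 0`. An XOR layer and a multiplexer layer
    -- recombine them, so each variable costs two layers and doubles the number of functions.
    let H' : κ × Bool → (ι → Bool) → Bool := fun k b => H k.1 (Function.update b (v k.1 0) k.2)
    have h₁ := ih (κ := κ × Bool) (fun k j => v k.1 j.succ) H' (by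
      intro k b b' hb
      refine hH k.1 ?_
      rintro _ ⟨j, rfl⟩
      -- The selection `v k` may repeat the pivot; the update then overrides both values.
      by_cases hj : v k.1 j = v k.1 0
      · simp [hj]
      · have : j ≠ 0 := fun h => hj (by rw [h])
        obtain ⟨j, rfl⟩ := Fin.exists_succ_eq.2 this
        simpa [Function.update_of_ne hj] using hb _ ⟨j, rfl⟩)
    let G : (κ × Bool) ⊕ (κ × Bool) ⊕ ι → X → Bool :=
      Sum.elim (fun k x => H' k fun i => F i x)
        (Sum.elim (fun k x => xor (F (v k.1 0) x) (H' k fun i => F i x)) F)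
    have h₂ : Reaches (Sum.elim (fun k x => H' k fun i => F i x) F) G 1
        (4 * 2 ^ (m + 1) * Fintype.card κ + Fintype.card ι) := by
      refine Reaches.of_isLayer ?_ ?_
      · rintro (k | k | i)
        · exact exists_isAffine_copy _ (Sum.inl k)
        · exact exists_isAffine_xor _ (Sum.inr (v k.1 0)) (Sum.inl k)
        · exact exists_isAffine_copy _ (Sum.inr i)
      · simp only [Fintype.card_sum, Fintype.card_prod, Fintype.card_bool]
        have := Nat.mul_le_mul_right (Fintype.card κ) (Nat.one_le_two_pow (n := m + 1))
        linarith
    have h₃ : Reaches G (Sum.elim (fun k x => H k fun i => F i x) F) 1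
        (4 * 2 ^ (m + 1) * Fintype.card κ + Fintype.card ι) := by
      refine Reaches.of_isLayer ?_ ?_
      · rintro (k | i)
        · obtain ⟨g, hg, hgx⟩ := exists_isAffine_cond G (F (v k 0)) (Sum.inl (k, true))
            (Sum.inl (k, false)) (Sum.inr (Sum.inl (k, true))) (Sum.inr (Sum.inl (k, false)))
            (fun _ => rfl) (fun _ => rfl)
          refine ⟨g, hg, fun x => ?_⟩
          rw [hgx]
          have : H k (fun i => F i x) = H' (k, F (v k 0) x) fun i => F i x :=
            congrArg (H k) (Function.update_eq_self (v k 0) fun i => F i x).symm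
          rw [Sum.elim_inl, this]
          cases F (v k 0) x <;> rfl
        · exact exists_isAffine_copy G (Sum.inr (Sum.inr i))
      · rw [Fintype.card_sum]
        have := Nat.mul_le_mul_right (Fintype.card κ) (Nat.one_le_two_pow (n := m + 1))
        linarith
    have h₁ := h₁.mono (W' := 4 * 2 ^ (m + 1) * Fintype.card κ + Fintype.card ι) (by
      rw [Fintype.card_prod, Fintype.card_bool, pow_succ]
      apply le_of_eq
      ring)
    exact (h₁.trans h₂).trans h₃

/-- If every member of `G` is determined by the members of `F` selected by `v`, then `G` is computed
from `F` in a depth that depends only on the number of selected members. -/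
theorem reaches_of_determined {X ι κ A : Type} [Fintype ι] [Nonempty ι] [Fintype κ] [Nonempty κ]
    [Fintype A] {F : ι → X → Bool} {G : κ → X → Bool} (v : κ → A → ι)
    (h : ∀ k x y, (∀ a, F (v k a) x = F (v k a) y) → G k x = G k y) :
    Reaches F G (2 * Fintype.card A + 2)
      (4 * 2 ^ Fintype.card A * Fintype.card κ + Fintype.card ι) := by
  have hfac : ∀ k, Function.FactorsThrough (G k) fun x a => F (v k a) x :=
    fun k x y hxy => h k x y (congrFun hxy)
  let H : κ → (ι → Bool) → Bool :=
    fun k b => Function.extend (fun x a => F (v k a) x) (G k) (fun _ => false) fun a => b (v k a)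
  have hH : ∀ k x, H k (fun i => F i x) = G k x := fun k x => (hfac k).extend_apply _ x
  have h₁ := reaches_sum_of_dependsOn F (Fintype.card A)
    (fun k j => v k ((Fintype.equivFin A).symm j)) H (by
      intro k b b' hb
      refine congrArg (Function.extend (fun x a => F (v k a) x) (G k) _) (funext fun a => ?_)
      exact hb _ ⟨Fintype.equivFin A a, by simp⟩)
  refine h₁.trans (Reaches.of_isLayer (fun k => ?_) ?_)
  · simpa only [Sum.elim_inl, hH] using
      exists_isAffine_copy (Sum.elim (fun k x => H k fun i => F i x) F) (Sum.inl k)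
  · have := Nat.mul_le_mul_right (Fintype.card κ) (Nat.one_le_two_pow (n := Fintype.card A))
    linarith

/-! ### Locality of a machine operation and its simulation -/

namespace BoolTM

/-- The bits describing a configuration up to distance `R` from the heads. -/
abbrev Window (M : BoolTM) (R : ℕ) : Type :=
  M.Q ⊕ (Fin (M.k + 1) × Finset.Icc (-R : ℤ) R × M.Γ)

open Classical in
/-- The value of a bit of the window: whether the machine is in the given state, or whether the
given cell holds the given symbol. -/
noncomputable def Cfg.bit {M : BoolTM} (C : M.Cfg) {R : ℕ} : M.Window R → Bool
  | .inl q => decide (C.state = q)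
  | .inr (j, p, γ) => decide ((C.tape j).nth p = γ)

instance (M : BoolTM) (R : ℕ) : Nonempty (M.Window R) := ⟨.inl M.start⟩

/-- Cells are indexed relative to the head, so a move shifts the whole tape by one cell. -/
theorem updateTape_nth_eq {M : BoolTM} (a : M.Γ × Option Dir) {τ τ' : Tape M.Γ} (p : ℤ)
    (h₁ : τ.nth (p - 1) = τ'.nth (p - 1)) (h₂ : τ.nth p = τ'.nth p)
    (h₃ : τ.nth (p + 1) = τ'.nth (p + 1)) : (updateTape a τ).nth p = (updateTape a τ').nth p := by
  obtain ⟨γ, _ | _ | _⟩ := a <;>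
    simp [updateTape, Tape.write_nth, h₁, h₂, h₃]

/-- The bits that determine the value of a bit of the window after one operation: the state, the
symbols under the heads, and the symbols at and next to the cell in question. -/
abbrev Relevant (M : BoolTM) : Type :=
  M.Q ⊕ (Fin (M.k + 1) × M.Γ) ⊕ (Fin 3 × M.Γ)

/-- The location of the relevant bits in a window of radius `R + 1`. -/
def relevant (M : BoolTM) (R : ℕ) : M.Window R → M.Relevant → M.Window (R + 1)
  | _, .inl q => .inl q
  | _, .inr (.inl (j, γ)) => .inr (j, ⟨0, by simp; omega⟩, γ)
  -- A filler location: a state bit needs no neighbouring cells.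
  | .inl _, .inr (.inr (_, γ)) => .inr (0, ⟨0, by simp; omega⟩, γ)
  | .inr (j, p, _), .inr (.inr (e, γ)) => .inr (j, ⟨p + (e : ℤ) - 1, by
      have := Finset.mem_Icc.1 p.2
      have := e.2
      rw [Finset.mem_Icc]
      push_cast
      omega⟩, γ)

/-- The encoding is one-hot, so testing the bit of the value found in `C'` already forces equal
states and symbols in `C`. -/
theorem step_bit_eq {M : BoolTM} {R : ℕ} (C C' : M.Cfg) (k : M.Window R)
    (h : ∀ a, C.bit (M.relevant R k a) = C'.bit (M.relevant R k a)) :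
    (M.step C).bit k = (M.step C').bit k := by
  have hs : C.state = C'.state := by
    simpa [relevant, Cfg.bit] using h (.inl C'.state)
  have hh : (fun j => (C.tape j).head) = fun j => (C'.tape j).head := by
    funext j
    have h := h (.inr (.inl (j, (C'.tape j).head)))
    simp only [relevant, Cfg.bit, decide_eq_decide] at h
    exact h.2 rfl
  obtain q | ⟨j, p, γ⟩ := k
  · simp only [Cfg.bit, step, hs, hh]
    split_ifs <;> simp [hs]
  · have hn : ∀ e : Fin 3, (C.tape j).nth (p + (e : ℤ) - 1) = (C'.tape j).nth (p + (e : ℤ) - 1) := by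
      intro e
      simpa [relevant, Cfg.bit] using h (.inr (.inr (e, (C'.tape j).nth (p + (e : ℤ) - 1))))
    have h₀ := hn 0
    have h₁ := hn 1
    have h₂ := hn 2
    norm_num at h₀ h₁ h₂
    have h₂ : (C.tape j).nth (p + 1) = (C'.tape j).nth (p + 1) := by
      convert h₂ using 2 <;> ring
    have hp : ((M.step C).tape j).nth p = ((M.step C').tape j).nth p := by
      rw [step, step, hs, hh]
      split_ifs
      · exact h₁
      · exact updateTape_nth_eq _ _ h₀ h₁ h₂
    simp only [Cfg.bit, decide_eq_decide, hp]

theorem init_tape_nth {M : BoolTM} {d : ℕ} (x : Fin d → Bool) (j : Fin (M.k + 1)) (p : ℤ) :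
    ((M.init x).tape j).nth p =
      if h : j = 0 ∧ 0 ≤ p ∧ p.toNat < d then M.bit (x ⟨p.toNat, h.2.2⟩) else default := by
  have hneg : ∀ l : List M.Γ, ∀ n : ℕ, (Tape.mk₁ l).nth (Int.negSucc n) = default := by
    intro l n
    change (ListBlank.mk []).nth n = default
    simp [ListBlank.nth_mk]
  have hnat : ∀ l : List M.Γ, ∀ n : ℕ, (Tape.mk₁ l).nth n = l.getI n := fun l n =>
    (Tape.mk'_nth_nat _ _ _).trans (ListBlank.nth_mk _ _)
  obtain n | n := p
  · by_cases hj : j = 0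
    · by_cases hn : n < d
      · simp [init, hj, hn, hnat, List.getI_eq_getElem]
      · have h := List.getI_eq_default (List.ofFn fun i => M.bit (x i)) (n := n) (by simpa using hn)
        simp [init, hj, hn, hnat, h]
    · simp [init, hj, hnat]
  · simp [init, hneg]

/-- Each initial bit is constant or depends on a single input bit, so one layer suffices. -/
theorem isLayer_init (M : BoolTM) (d R : ℕ) :
    IsLayer (fun (i : Fin d) (x : Fin d → Bool) => x i)
      fun (k : M.Window R) x => (M.init x).bit k := by
  classical
  rintro (q | ⟨j, p, γ⟩)
  · exact exists_isAffine_const _ (decide (M.start = q))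
  · simp only [Cfg.bit, init_tape_nth]
    by_cases h : j = 0 ∧ (0 : ℤ) ≤ p ∧ (p : ℤ).toNat < d
    · simp only [dif_pos h]
      convert exists_isAffine_unary (fun (i : Fin d) (x : Fin d → Bool) => x i)
        ⟨(p : ℤ).toNat, h.2.2⟩ (fun a => decide (M.bit a = γ))
    · simp only [dif_neg h]
      convert exists_isAffine_const (fun (i : Fin d) (x : Fin d → Bool) => x i)
        (decide (default = γ))

theorem card_window (M : BoolTM) (R : ℕ) : Fintype.card (M.Window R) =
    Fintype.card M.Q + (M.k + 1) * ((2 * R + 1) * Fintype.card M.Γ) := by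
  simp only [Fintype.card_sum, Fintype.card_prod, Fintype.card_fin, Fintype.card_coe, Int.card_Icc]
  congr 3
  omega

theorem card_window_le {M : BoolTM} {s : ℕ} (hM : M.size ≤ s) (R : ℕ) :
    Fintype.card (M.Window R) ≤ (s + 2 * s ^ 2) * (R + 1) := by
  rw [size] at hM
  have h₁ : (M.k + 1) * ((2 * R + 1) * Fintype.card M.Γ) ≤ s * ((2 * R + 1) * s) := by
    gcongr <;> omega
  rw [card_window]
  nlinarith [Nat.zero_le (s * R), Nat.zero_le (s ^ 2)]

theorem card_relevant_le {M : BoolTM} {s : ℕ} (hM : M.size ≤ s) :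
    Fintype.card M.Relevant ≤ s + (s * s + 3 * s) := by
  rw [size] at hM
  simp only [Fintype.card_sum, Fintype.card_prod, Fintype.card_fin]
  gcongr <;> omega

/-- `i` operations of the machine are simulated by a network whose depth is linear in `i`. -/
theorem reaches_iterate {M : BoolTM} {s : ℕ} (hM : M.size ≤ s) (d n i : ℕ) (hi : i ≤ n) :
    Reaches (fun (i : Fin d) (x : Fin d → Bool) => x i)
      (fun (k : M.Window (n - i)) x => (M.step^[i] (M.init x)).bit k)
      (1 + i * (2 * Fintype.card M.Relevant + 2))
      ((4 * 2 ^ (s + (s * s + 3 * s)) + 1) * ((s + 2 * s ^ 2) * (n + 1))) := by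
  induction i with
  | zero =>
    rw [Nat.zero_mul]
    refine Reaches.of_isLayer (M.isLayer_init d _) ((card_window_le hM _).trans ?_)
    exact Nat.le_mul_of_pos_left _ (Nat.succ_pos _)
  | succ i ih =>
    obtain ⟨R, rfl⟩ := Nat.exists_eq_add_of_le hi
    have e₁ : i + 1 + R - i = R + 1 := by omega
    have e₂ : i + 1 + R - (i + 1) = R := by omega
    have ih := ih (by omega)
    rw [e₁] at ih
    rw [e₂]
    have h := reaches_of_determined
      (F := fun (k : M.Window (R + 1)) (x : Fin d → Bool) => (M.step^[i] (M.init x)).bit k)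
      (G := fun (k : M.Window R) x => (M.step^[i + 1] (M.init x)).bit k) (M.relevant R) (by
        intro k x y hxy
        simp only [Function.iterate_succ_apply']
        exact step_bit_eq _ _ k hxy)
    have h := ih.trans (h.mono ?_)
    · convert h using 1
      ring
    · have h₁ := (card_window_le hM R).trans
        (Nat.mul_le_mul_left (s + 2 * s ^ 2) (show R + 1 ≤ i + 1 + R + 1 by omega))
      have h₂ := (card_window_le hM (R + 1)).trans
        (Nat.mul_le_mul_left (s + 2 * s ^ 2) (show R + 1 + 1 ≤ i + 1 + R + 1 by omega))
      rw [add_mul _ 1, one_mul]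
      gcongr
      · norm_num
      · exact card_relevant_le hM

theorem step_iterate_state_of_halted {M : BoolTM} {C : M.Cfg}
    (hC : C.state = M.accept ∨ C.state = M.reject) (n : ℕ) : M.step^[n] C = C :=
  Function.iterate_fixed (by rw [step, if_pos hC]) n

theorem ImplementsInTime.state_eq {M : BoolTM} {d n : ℕ} {f : (Fin d → Bool) → Bool}
    (h : M.ImplementsInTime f n) (x : Fin d → Bool) :
    (M.step^[n] (M.init x)).state = if f x = true then M.accept else M.reject := by
  obtain ⟨m, hm, hs⟩ := h x
  obtain ⟨r, rfl⟩ := Nat.exists_eq_add_of_le' hm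
  rw [Function.iterate_add_apply, step_iterate_state_of_halted _ r, hs]
  rw [hs]
  split_ifs <;> simp

end BoolTM

/-! ### Choice of constants and conclusion -/

theorem Network.WeightBounded.mono {L L' : ℝ} (hL : L ≤ L') {m : ℕ} {N : Network m}
    (h : N.WeightBounded L) : N.WeightBounded L' := by
  induction N with
  | output v => exact le_trans h hL
  | hidden _ _ _ ih => exact ⟨fun j => (h.1 j).trans hL, ih h.2⟩

theorem ComputesFrom.exists_mem_networkClass {d t n : ℕ} {f : (Fin d → Bool) → Bool}
    (h : ComputesFrom (fun (i : Fin d) x => x i) f t n) {L : ℝ} (hL : 2 ≤ L) :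
    ∃ g ∈ networkClass d t n squareActivation L,
      ∀ x : Fin d → Bool, g (fun i => boolToReal (x i)) = boolToReal (f x) := by
  obtain ⟨N, ht, hn, hw, hN⟩ := h d (Equiv.refl _)
  exact ⟨_, ⟨N, ht, hn, hw.mono hL, rfl⟩, hN⟩

theorem BoolTM.ImplementsInTime.computesFrom {M : BoolTM} {s d n t u : ℕ}
    {f : (Fin d → Bool) → Bool} (hM : M.size ≤ s) (h : M.ImplementsInTime f n)
    (hu₁ : 1 + n * (2 * (s + (s * s + 3 * s)) + 2) ≤ u)
    (hu₂ : (4 * 2 ^ (s + (s * s + 3 * s)) + 1) * ((s + 2 * s ^ 2) * (n + 1)) ≤ u)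
    (ht : u + 2 ≤ t) : ComputesFrom (fun (i : Fin d) x => x i) f t (t ^ 2) := by
  classical
  obtain ⟨N, hN, hr⟩ := BoolTM.reaches_iterate hM d n n le_rfl
  have hN := hN.trans (Nat.mul_le_mul_left _ hu₂)
  have hD : 1 + n * (2 * Fintype.card M.Relevant + 2) ≤ u := by
    refine le_trans ?_ hu₁
    gcongr
    exact BoolTM.card_relevant_le hM
  generalize 1 + n * (2 * Fintype.card M.Relevant + 2) = D at *
  obtain ⟨r, rfl⟩ := Nat.exists_eq_add_of_le' (show D + 2 ≤ t by omega)
  -- With `t = r + D + 2`, the simulation uses `N ≤ D * u ≤ D * t` neurons, leaving at least `(r +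
  -- 2) * t` of the `t ^ 2` for the last `r + 2` layers.
  have hle : r + 2 + N ≤ (r + (D + 2)) ^ 2 := by
    have : D * u ≤ D * (r + (D + 2)) := Nat.mul_le_mul_left _ (by omega)
    nlinarith
  have h₁ := hr _ _ _ (ComputesFrom.padded
    (fun (k : M.Window (n - n)) x => (M.step^[n] (M.init x)).bit k) (.inl M.accept)
    (t := r + 2) (n := (r + (D + 2)) ^ 2 - N) (by omega) (by omega))
  convert h₁ using 1
  · funext x
    simp only [BoolTM.Cfg.bit, h.state_eq]
    cases f x <;> simp [M.accept_ne_reject.symm]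
  · omega
  · omega

theorem mainTheorem5 (T : ℕ → ℕ) (s : ℕ) :
    ∃ b c : ℝ, 0 < b ∧ 0 < c ∧
      ∀ d t : ℕ, t = ⌊c * (T d : ℝ) * Real.log (T d : ℝ) + b⌋₊ →
        ∀ f ∈ turingClass s T d,
          ∃ g ∈ networkClass d t (t ^ 2) squareActivation b,
            ∀ x : Fin d → Bool, g (fun i => boolToReal (x i)) = boolToReal (f x) := by
  obtain ⟨A, hA⟩ : ∃ A, A = 2 * (s + (s * s + 3 * s)) + 2 := ⟨_, rfl⟩
  obtain ⟨B, hB⟩ : ∃ B, B = (4 * 2 ^ (s + (s * s + 3 * s)) + 1) * (s + 2 * s ^ 2) := ⟨_, rfl⟩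
  obtain ⟨K, hK⟩ : ∃ K, K = 1 + A + B := ⟨_, rfl⟩
  -- The aim is `t ≥ K * (T d + 1) + 2`. If `T d ≤ 1`, the additive constant suffices; otherwise
  -- `log (T d) ≥ log 2 > 2 / 3` makes the main term at least `2 * K * T d`.
  refine ⟨2 * K + 2, 3 * K, by positivity, by rw [hK]; push_cast; positivity, ?_⟩
  rintro d t ht f ⟨M, hM, hf⟩
  refine (hf.computesFrom (t := t) (u := K * (T d + 1)) hM ?_ ?_ ?_).exists_mem_networkClass
    (by linarith [Nat.cast_nonneg (α := ℝ) K])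
  · rw [← hA, hK]
    nlinarith [Nat.zero_le (B * T d)]
  · rw [← mul_assoc, ← hB]
    exact Nat.mul_le_mul_right _ (by omega)
  · rw [ht]
    apply Nat.le_floor
    push_cast
    have hK0 : (0 : ℝ) ≤ K := Nat.cast_nonneg K
    obtain h | h := le_or_gt (T d) 1
    · have h0 : (T d : ℝ) ≤ 1 := by exact_mod_cast h
      have : (0 : ℝ) ≤ 3 * K * T d * Real.log (T d) := by
        have := Real.log_natCast_nonneg (T d)
        positivity
      nlinarith
    · have h2 : (2 : ℝ) ≤ T d := by exact_mod_cast h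
      have hlog : 2 / 3 ≤ Real.log (T d) :=
        (by linarith [Real.log_two_gt_d9] : (2 / 3 : ℝ) ≤ Real.log 2).trans
          (Real.log_le_log two_pos h2)
      have h3 : 3 * K * T d * (2 / 3) ≤ 3 * K * T d * Real.log (T d) :=
        mul_le_mul_of_nonneg_left hlog (by positivity)
      nlinarith
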